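/- Let $\mathbb N=\{0,1,2,\ldots\}$ and $\mathbb Z^+=\{1,2,3,\ldots\}$. (i) Let $c\in\{1,2\}$. Then each $n\in\mathbb Z^+$ can be written as $n=x^2+y^2+z^2+w^2$ with $x,y,z,w\in\mathbb Z$ and $x+y+2z\in\{c\cdot 4^k: k\in\mathbb N\}$. (ii) Each $n\in\mathbb Z^+$ can be written as $n=x^2+y^2+z^2+w^2$ with $x,y,z,w\in\mathbb Z$ and $x+2y+2z\in\{4^k: k\in\mathbb N\}$. Also, for each $n\in\mathbb Z^+$ we can write $n^2=x^2+y^2+z^2+w^2$ with $x,y,z,w\in\mathbb Z$ and $x+2y+2z\in\{8^k: k\in\mathbb N\}$. (iii) If $n\in\mathbb Z^+$ does not belong to $\bigcup_{k\in\mathbb N}\{2^{4k},2^{4k+3}\}$, then $n=x^2+y^2+z^2+w^2$ for some $x,y,z,w\in\mathbb Z$ with $x+2y+2z\in\{3\cdot 4^k: k\in\mathbb N\}$. Consequently, every integer $n>1$ can be written as $n=x^2+y^2+z^2+w^2$ with $x,y,z,w\in\mathbb Z$ and $x+2y+2z\in\{3\cdot 2^k: k\in\mathbb N\}$. -/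

import Mathlib

/-! If x+y+2z = m, then 6n − m² = 2(x+y−z)² + 3(x−y)² + 6w². If x+2y+2z = m, then 9n − m² =
(2x+y−2z)² + (2x−2y+z)² + (3w)². When 3 ∤ m, congruences modulo 2, 3 and 9 allow the converse: three
squares with sum 6n − m² or 9n − m² can be permuted and given signs so that integral x, y, z, w come
back. For x+2y+2z = 3m the second identity, divided by 9, starts from n − m² instead.

So each claim asks for an m in a geometric progression such that 6n − m², 9n − m² or n − m² is
positive and not of the form 4^a(8b+7). Scaling the variables by q disposes of q² ∣ n (of q ∣ n when
n² is represented); otherwise a few small m suffice, apart from isolated explicit cases.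

The three squares theorem is proved by Dirichlet's theorem and quadratic reciprocity, which give a
positive ternary form of determinant one representing n; reduction theory identifies it with
x²+y²+z². -/

/-- Six integers are the entries `u⬝u, u⬝v, u⬝w, v⬝v, v⬝w, w⬝w` of the Gram matrix of three vectors
of `ℤ³`. -/
def IsTernaryGram (a b c d e f : ℤ) : Prop :=
  ∃ u v w : Fin 3 → ℤ, u ⬝ᵥ u = a ∧ u ⬝ᵥ v = b ∧ u ⬝ᵥ w = c ∧ v ⬝ᵥ v = d ∧ v ⬝ᵥ w = e ∧ w ⬝ᵥ w = f

namespace IsTernaryGram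

variable {a b c d e f : ℤ}

theorem swap_fst_snd (h : IsTernaryGram d b e a c f) : IsTernaryGram a b c d e f := by
  obtain ⟨u, v, w, h1, h2, h3, h4, h5, h6⟩ := h
  exact ⟨v, u, w, h4, by rw [dotProduct_comm, h2], h5, h1, h3, h6⟩

theorem swap_snd_trd (h : IsTernaryGram a c b f e d) : IsTernaryGram a b c d e f := by
  obtain ⟨u, v, w, h1, h2, h3, h4, h5, h6⟩ := h
  exact ⟨u, w, v, h1, h3, h2, h6, by rw [dotProduct_comm, h5], h4⟩

theorem shift_snd (t : ℤ)
    (h : IsTernaryGram a (b + t * a) c (d + 2 * t * b + t ^ 2 * a) (e + t * c) f) :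
    IsTernaryGram a b c d e f := by
  obtain ⟨u, v, w, h1, h2, h3, h4, h5, h6⟩ := h
  have h2' := dotProduct_comm u v
  refine ⟨u, v - t • u, w, h1, ?_, h3, ?_, ?_, h6⟩ <;>
    simp only [sub_dotProduct, dotProduct_sub, smul_dotProduct, dotProduct_smul, smul_eq_mul,
      ← h2', h1, h2, h3, h4, h5] <;> ring

theorem shift_trd (t : ℤ)
    (h : IsTernaryGram a b (c + t * b) d (e + t * d) (f + 2 * t * e + t ^ 2 * d)) :
    IsTernaryGram a b c d e f := by
  obtain ⟨u, v, w, h1, h2, h3, h4, h5, h6⟩ := h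
  have h2' := dotProduct_comm v w
  refine ⟨u, v, w - t • v, h1, h2, ?_, h4, ?_, ?_⟩ <;>
    simp only [sub_dotProduct, dotProduct_sub, smul_dotProduct, dotProduct_smul, smul_eq_mul,
      ← h2', h2, h3, h4, h5, h6] <;> ring

theorem one : IsTernaryGram 1 0 0 1 0 1 :=
  ⟨![1, 0, 0], ![0, 1, 0], ![0, 0, 1], by simp [dotProduct, Fin.sum_univ_three]⟩

end IsTernaryGram

theorem Int.exists_four_mul_add_mul_sq_le (b : ℤ) {a : ℤ} (ha : 0 < a) :
    ∃ t : ℤ, 4 * (b + t * a) ^ 2 ≤ a ^ 2 := by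
  refine ⟨-((2 * b + a) / (2 * a)), ?_⟩
  have h1 := Int.emod_add_mul_ediv (2 * b + a) (2 * a)
  have h2 := Int.emod_nonneg (2 * b + a) (by omega : 2 * a ≠ 0)
  have h3 := Int.emod_lt_of_pos (2 * b + a) (by omega : 0 < 2 * a)
  set q := (2 * b + a) / (2 * a)
  have h4 : -a ≤ 2 * (b + -q * a) := by nlinarith
  have h5 : 2 * (b + -q * a) ≤ a := by nlinarith
  nlinarith

/-- A positive definite integral ternary quadratic form of determinant one is a sum of the squares
of three integral linear forms. -/
theorem isTernaryGram_of_det_eq_one {a b c d e f : ℤ} (ha : 0 < a) (hB : 0 < a * d - b ^ 2)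
    (hdet : a * d * f + 2 * b * c * e - a * e ^ 2 - d * c ^ 2 - f * b ^ 2 = 1) :
    IsTernaryGram a b c d e f := by
  obtain ⟨A, hA⟩ : ∃ A : ℕ, A = a.toNat := ⟨_, rfl⟩
  induction A using Nat.strong_induction_on generalizing a b c d e f with
  | _ A ihA =>
  obtain ⟨B, hB'⟩ : ∃ B : ℕ, B = (a * d - b ^ 2).toNat := ⟨_, rfl⟩
  induction B using Nat.strong_induction_on generalizing b c d e f with
  | _ B ihB =>
  -- Here B = ad − b² can be lowered with a fixed: reduce the binary form (B, C, F) of cofactors to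
  -- |C| ≤ B/2. Its determinant is a · det = a, so BF = a + C² < B².
  by_cases hred : 4 * a < 3 * (a * d - b ^ 2) ^ 2
  · obtain ⟨t, ht⟩ := Int.exists_four_mul_add_mul_sq_le (a * e - b * c) hB
    apply IsTernaryGram.shift_trd t
    apply IsTernaryGram.swap_snd_trd
    set B' := a * d - b ^ 2 with hB2
    set C := a * e - b * c + t * B' with hC
    set F := a * (f + 2 * t * e + t ^ 2 * d) - (c + t * b) ^ 2 with hF
    have hBF : B' * F = a + C ^ 2 := by
      rw [hF, hC, hB2]; linear_combination a * hdet
    have hF0 : 0 < F := by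
      by_contra! h
      nlinarith [sq_nonneg C]
    have hFB : F < B' := by
      by_contra! h
      nlinarith
    exact ihB F.toNat (by omega) hF0 (by linear_combination hdet) rfl
  · obtain ⟨t, ht⟩ := Int.exists_four_mul_add_mul_sq_le b ha
    apply IsTernaryGram.shift_snd t
    have hBt : a * (d + 2 * t * b + t ^ 2 * a) - (b + t * a) ^ 2 = a * d - b ^ 2 := by ring
    have hdet' : a * (d + 2 * t * b + t ^ 2 * a) * f + 2 * (b + t * a) * c * (e + t * c) -
      a * (e + t * c) ^ 2 - (d + 2 * t * b + t ^ 2 * a) * c ^ 2 - f * (b + t * a) ^ 2 = 1 := by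
      linear_combination hdet
    rw [← hBt] at hB hred
    generalize d + 2 * t * b + t ^ 2 * a = d' at *
    generalize b + t * a = b' at *
    generalize e + t * c = e' at *
    have hd : 0 < d' := by
      by_contra! h
      nlinarith [sq_nonneg b']
    by_cases hda : d' < a
    · apply IsTernaryGram.swap_fst_snd
      exact ihA d'.toNat (by omega) hd (by linarith) (by linear_combination hdet') rfl
    · push Not at hda hred
      -- With 3B² ≤ 4a this bounds a: 27a⁴ ≤ 48B² ≤ 64a, so a = 1.
      have h1 : 3 * a ^ 2 ≤ 4 * (a * d' - b' ^ 2) := by nlinarith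
      have ha1 : a = 1 := by
        by_contra hne
        have h2 : 2 ≤ a := by omega
        have h3 : 9 * a ^ 4 ≤ 16 * (a * d' - b' ^ 2) ^ 2 := by nlinarith [sq_nonneg a]
        have h4 : 27 * (a * a ^ 3) ≤ 64 * a := by nlinarith
        have h5 : 8 ≤ a ^ 3 := by nlinarith [sq_nonneg (a - 2)]
        nlinarith
      subst ha1
      have hb0 : b' = 0 := by
        by_contra hne
        have : 0 < b' ^ 2 := by positivity
        omega
      subst hb0
      have hd1 : d' = 1 := by nlinarith
      subst hd1
      apply IsTernaryGram.shift_trd (-e')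
      apply IsTernaryGram.swap_snd_trd
      apply IsTernaryGram.shift_snd (-c)
      convert IsTernaryGram.one using 1 <;> first | ring1 | linear_combination hdet'

/-! ### The three squares theorem -/

/-- An integer is the sum of the squares of three integers. -/
def IsSumThreeSquares (n : ℤ) : Prop :=
  ∃ x y z : ℤ, n = x ^ 2 + y ^ 2 + z ^ 2

/-- With sq = t² + b, the Gram matrix with rows (s, t, 1), (t, q, 0), (1, 0, n) has determinant bn −
q = 1, and its last diagonal entry is n. -/
theorem isSumThreeSquares_of_dvd {n b q t : ℤ} (hb : 0 < b) (hq : 0 < q)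
    (hqb : q = b * n - 1) (ht : q ∣ t ^ 2 + b) : IsSumThreeSquares n := by
  obtain ⟨s, hs⟩ := ht
  have hs0 : 0 < s := by
    by_contra! h
    nlinarith [sq_nonneg t]
  obtain ⟨u, v, w, -, -, -, -, -, h⟩ := isTernaryGram_of_det_eq_one (a := s) (b := t) (c := 1)
    (d := q) (e := 0) (f := n) hs0 (by linarith) (by subst hqb; linear_combination (-n) * hs)
  refine ⟨w 0, w 1, w 2, ?_⟩
  rw [← h]
  simp [dotProduct, Fin.sum_univ_three, sq]

theorem exists_dvd_sq_add_of_jacobiSym_neg_eq_one {p b : ℕ} [Fact p.Prime]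
    (h : jacobiSym (-b) p = 1) : ∃ t : ℤ, (p : ℤ) ∣ t ^ 2 + b := by
  obtain ⟨y, hy⟩ := ZMod.isSquare_of_jacobiSym_eq_one h
  refine ⟨(y.val : ℤ), ?_⟩
  rw [← ZMod.intCast_zmod_eq_zero_iff_dvd]
  push_cast at hy ⊢
  rw [ZMod.natCast_zmod_val, sq, ← hy]
  ring

/-- Modulo b, kp ≡ −1. This evaluates (p/b), which reciprocity then turns into (b/p). -/
theorem jacobiSym_mul_eq_of_add_one_eq_mul {k p b n : ℕ} (hb : Odd b) (h : k * p + 1 = b * n) :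
    jacobiSym k b * jacobiSym p b = ZMod.χ₄ b := by
  rw [← jacobiSym.mul_left, ← jacobiSym.at_neg_one hb]
  apply jacobiSym.mod_left'
  apply Int.ModEq.symm
  rw [Int.modEq_iff_dvd]
  exact ⟨n, by rw [sub_neg_eq_add]; exact_mod_cast h⟩

theorem exists_prime_mul_four_mul_add {n r : ℕ} (hn : n ≠ 0) (hr : r.Coprime (4 * n)) :
    ∃ p m : ℕ, p.Prime ∧ p = 4 * n * m + r := by
  obtain ⟨p, hp, hpp, hmod⟩ := Nat.forall_exists_prime_gt_and_modEq r (by omega : 4 * n ≠ 0) hr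
  obtain ⟨m, hm⟩ := (Nat.modEq_iff_dvd' hp.le).1 hmod.symm
  exact ⟨p, m, hpp, by omega⟩

theorem Nat.coprime_four_mul_of_mul_add_one_eq_mul {k r c n : ℕ} (hr : Odd r)
    (h : k * r + 1 = c * n) : r.Coprime (4 * n) := by
  refine Nat.Coprime.mul_right ((Nat.coprime_two_right.2 hr).pow_right 2) ?_
  rw [← Nat.isCoprime_iff_coprime]
  exact ⟨-k, c, by linear_combination (-1 : ℤ) * (by exact_mod_cast h : (k * r + 1 : ℤ) = c * n)⟩

theorem isSumThreeSquares_of_mod_four_eq_two {n : ℕ} (hn : n % 4 = 2) :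
    IsSumThreeSquares n := by
  obtain ⟨p, m, hpp, hm⟩ := exists_prime_mul_four_mul_add (n := n) (by omega)
    (Nat.coprime_four_mul_of_mul_add_one_eq_mul (k := 1) (r := n - 1) (c := 1)
      (by rw [Nat.odd_iff]; omega) (by omega))
  obtain ⟨b, hb⟩ : ∃ b, b = 4 * m + 1 := ⟨_, rfl⟩
  have hpb : 1 * p + 1 = b * n := by
    have : n - 1 + 1 = n := by omega
    rw [hm, hb]
    linarith
  have := Fact.mk hpp
  have hbo : Odd b := by rw [Nat.odd_iff]; omega
  have hp4 : p % 4 = 1 := by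
    have h : 4 * n * m = 4 * (n * m) := by ring
    omega
  have hj : jacobiSym (-b) p = 1 := by
    have h := jacobiSym_mul_eq_of_add_one_eq_mul hbo hpb
    rw [Nat.cast_one, jacobiSym.one_left, one_mul, ZMod.χ₄_nat_one_mod_four (by omega)] at h
    rw [jacobiSym.neg _ (by rw [Nat.odd_iff]; omega), ZMod.χ₄_nat_one_mod_four hp4, one_mul,
      jacobiSym.quadratic_reciprocity_one_mod_four' hbo hp4, h]
  obtain ⟨t, ht⟩ := exists_dvd_sq_add_of_jacobiSym_neg_eq_one hj
  refine isSumThreeSquares_of_dvd (b := b) (q := p) (t := t) (by omega)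
    (by exact_mod_cast hpp.pos) ?_ ht
  have : (1 * p + 1 : ℤ) = b * n := by exact_mod_cast hpb
  linarith

theorem jacobiSym_neg_eq_one_of_two_mul_add_one_eq {p b n : ℕ} (h : 2 * p + 1 = b * n)
    (hbn : n % 8 = 3 ∧ b % 8 = 1 ∨ n % 8 = 1 ∧ b % 8 = 3 ∨ n % 8 = 5 ∧ b % 8 = 3) :
    jacobiSym (-b) p = 1 := by
  have hbo : Odd b := by rw [Nat.odd_iff]; omega
  have hmod : (2 * p + 1) % 8 = (b % 8) * (n % 8) % 8 := by rw [h, Nat.mul_mod]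
  have hpo : Odd p := by
    rw [Nat.odd_iff]
    rcases hbn with ⟨h1, h2⟩ | ⟨h1, h2⟩ | ⟨h1, h2⟩ <;> rw [h1, h2] at hmod <;> omega
  have hj := jacobiSym_mul_eq_of_add_one_eq_mul hbo h
  rw [Nat.cast_two, jacobiSym.at_two hbo, ZMod.χ₈_nat_eq_if_mod_eight,
    ZMod.χ₄_nat_eq_if_mod_four] at hj
  rw [jacobiSym.neg _ hpo, ZMod.χ₄_nat_eq_if_mod_four,
    jacobiSym.quadratic_reciprocity_if (Nat.odd_iff.1 hbo) (Nat.odd_iff.1 hpo) |>.symm]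
  rcases hbn with ⟨h1, h2⟩ | ⟨h1, h2⟩ | ⟨h1, h2⟩ <;> rw [h1, h2] at hmod
  · have h3 : b % 2 = 1 ∧ b % 4 = 1 ∧ p % 4 = 1 ∧ p % 2 = 1 := by omega
    simp [h2, h3] at hj ⊢
    omega
  · have h3 : b % 2 = 1 ∧ b % 4 = 3 ∧ p % 4 = 1 ∧ p % 2 = 1 := by omega
    simp [h2, h3] at hj ⊢
    omega
  · have h3 : b % 2 = 1 ∧ b % 4 = 3 ∧ p % 4 = 3 ∧ p % 2 = 1 := by omega
    simp [h2, h3] at hj ⊢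
    omega

theorem isSumThreeSquares_of_odd {n : ℕ} (hn : n % 2 = 1) (hn7 : n % 8 ≠ 7) :
    IsSumThreeSquares n := by
  -- The residue c of b modulo 8 is chosen so that r = (cn − 1)/2 is odd and reciprocity gives
  -- (−b/p) = 1. A prime p = 4nm + r then satisfies 2p + 1 = (8m + c)n.
  obtain ⟨c, hc⟩ : ∃ c, n % 8 = 3 ∧ c = 1 ∨ n % 8 = 1 ∧ c = 3 ∨ n % 8 = 5 ∧ c = 3 := by
    by_cases h : n % 8 = 3
    · exact ⟨1, by omega⟩
    · exact ⟨3, by omega⟩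
  obtain ⟨r, hr⟩ : ∃ r, 2 * r + 1 = c * n := by
    refine ⟨(c * n - 1) / 2, ?_⟩
    rcases hc with ⟨h, rfl⟩ | ⟨h, rfl⟩ | ⟨h, rfl⟩ <;> omega
  have hro : Odd r := by
    rw [Nat.odd_iff]
    rcases hc with ⟨h, rfl⟩ | ⟨h, rfl⟩ | ⟨h, rfl⟩ <;> omega
  obtain ⟨p, m, hpp, hm⟩ := exists_prime_mul_four_mul_add (n := n) (by omega)
    (Nat.coprime_four_mul_of_mul_add_one_eq_mul hro hr)
  obtain ⟨b, hb⟩ : ∃ b, b = 8 * m + c := ⟨_, rfl⟩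
  have hpb : 2 * p + 1 = b * n := by
    rw [hm, hb]
    linarith
  have := Fact.mk hpp
  obtain ⟨t, ht⟩ := exists_dvd_sq_add_of_jacobiSym_neg_eq_one
    (jacobiSym_neg_eq_one_of_two_mul_add_one_eq hpb (by omega))
  have hpo : p % 2 = 1 := by
    have h : 4 * n * m = 2 * (2 * n * m) := by ring
    rw [Nat.odd_iff] at hro
    omega
  -- The modulus is q = 2p and b is odd, so the root must be odd; adding p changes its parity.
  obtain ⟨s, hs, hso⟩ : ∃ s : ℤ, (p : ℤ) ∣ s ^ 2 + b ∧ s % 2 = 1 := by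
    rcases Int.emod_two_eq_zero_or_one t with h | h
    · refine ⟨t + p, ?_, by omega⟩
      have : (t + p) ^ 2 + b = t ^ 2 + b + p * (2 * t + p) := by ring
      exact this ▸ ht.add (dvd_mul_right _ _)
    · exact ⟨t, ht, h⟩
  have h2 : (2 : ℤ) ∣ s ^ 2 + b := by
    obtain ⟨u, rfl⟩ : ∃ u, s = 2 * u + 1 := ⟨s / 2, by omega⟩
    have h : (2 * u + 1) ^ 2 = 2 * (2 * u ^ 2 + 2 * u) + 1 := by ring
    omega
  refine isSumThreeSquares_of_dvd (b := b) (q := 2 * p) (t := s) (by omega)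
    (by have := hpp.pos; omega) ?_ (IsCoprime.mul_dvd ?_ h2 hs)
  · have : (2 * p + 1 : ℤ) = b * n := by exact_mod_cast hpb
    linarith
  · exact (Nat.isCoprime_iff_coprime (m := 2)).2
      (Nat.coprime_two_left.2 (Nat.odd_iff.2 hpo))

/-- **Three squares theorem** for integers not divisible by four. -/
theorem isSumThreeSquares_of_not_four_dvd {n : ℤ} (hn : 0 < n) (h4 : n % 4 ≠ 0)
    (h7 : n % 8 ≠ 7) : IsSumThreeSquares n := by
  lift n to ℕ using hn.le
  by_cases h : n % 4 = 2
  · exact isSumThreeSquares_of_mod_four_eq_two h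
  · exact isSumThreeSquares_of_odd (by omega) (by omega)

theorem IsSumThreeSquares.four_mul {n : ℤ} (h : IsSumThreeSquares n) :
    IsSumThreeSquares (4 * n) := by
  obtain ⟨x, y, z, rfl⟩ := h
  exact ⟨2 * x, 2 * y, 2 * z, by ring⟩

/-- **Three squares theorem**. -/
theorem isSumThreeSquares_or {n : ℤ} (hn : 0 < n) :
    IsSumThreeSquares n ∨ ∃ (a : ℕ) (b : ℤ), 0 ≤ b ∧ n = 4 ^ a * (8 * b + 7) := by
  lift n to ℕ using hn.le
  induction n using Nat.strong_induction_on with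
  | _ n ih =>
  by_cases h4 : n % 4 = 0
  · obtain ⟨k, rfl⟩ : ∃ k, n = 4 * k := ⟨n / 4, by omega⟩
    rcases ih k (by omega) (by omega) with h | ⟨a, b, hb, h⟩
    · left
      push_cast
      exact h.four_mul
    · refine Or.inr ⟨a + 1, b, hb, ?_⟩
      push_cast
      rw [h]
      ring
  · by_cases h7 : n % 8 = 7
    · exact Or.inr ⟨0, n / 8, by omega, by rw [pow_zero]; omega⟩
    · exact Or.inl (isSumThreeSquares_of_not_four_dvd (by omega) (by omega) (by omega))

/-- The three squares theorem, with the exceptions described modulo `16`. -/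
theorem isSumThreeSquares_or_mod {n : ℤ} (hn : 0 < n) :
    IsSumThreeSquares n ∨ n % 8 = 7 ∨ (28 ≤ n ∧ n % 32 = 28) ∨ (112 ≤ n ∧ n % 16 = 0) := by
  rcases isSumThreeSquares_or hn with h | ⟨a, b, hb, rfl⟩
  · exact Or.inl h
  · rcases a with _ | _ | a
    · rw [pow_zero]; omega
    · rw [zero_add, pow_one]; omega
    · have h1 : (4 : ℤ) ^ (a + 1 + 1) * (8 * b + 7) = 16 * (4 ^ a * (8 * b + 7)) := by ring
      have h2 : 1 ≤ (4 : ℤ) ^ a := one_le_pow₀ (by norm_num)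
      have h3 : 7 ≤ (4 : ℤ) ^ a * (8 * b + 7) := by nlinarith
      omega

/-! ### Choosing signs modulo 3 -/

theorem Int.sq_emod_three (p : ℤ) :
    p ^ 2 % 3 = 0 ∧ p % 3 = 0 ∨ p ^ 2 % 3 = 1 ∧ p % 3 = 1 ∨ p ^ 2 % 3 = 1 ∧ p % 3 = 2 := by
  rcases (by omega : p % 3 = 0 ∨ p % 3 = 1 ∨ p % 3 = 2) with h | h | h <;>
    simp [sq, Int.mul_emod, h]

theorem Int.exists_sq_eq_of_emod_three {m : ℤ} (hm : m % 3 ≠ 0) (p : ℤ) :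
    ∃ q, q ^ 2 = p ^ 2 ∧ (p ^ 2 % 3 = 0 ∧ q % 3 = 0 ∨ p ^ 2 % 3 = 1 ∧ q % 3 = m % 3) := by
  rcases Int.sq_emod_three p with h | h | h
  · exact ⟨p, rfl, by omega⟩
  all_goals
    by_cases h' : p % 3 = m % 3
    · exact ⟨p, rfl, by omega⟩
    · exact ⟨-p, by ring, by omega⟩

/-- A sum of three squares that is `2` modulo `3` has exactly one square divisible by `3`. -/
theorem IsSumThreeSquares.exists_of_emod_three {N m : ℤ} (hm : m % 3 ≠ 0)
    (h : IsSumThreeSquares N) (hN : N % 3 = 2) :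
    ∃ p q r : ℤ, N = p ^ 2 + q ^ 2 + r ^ 2 ∧ p % 3 = m % 3 ∧ q % 3 = m % 3 ∧ r % 3 = 0 := by
  obtain ⟨p₀, q₀, r₀, h⟩ := h
  obtain ⟨p, hp, hp'⟩ := Int.exists_sq_eq_of_emod_three hm p₀
  obtain ⟨q, hq, hq'⟩ := Int.exists_sq_eq_of_emod_three hm q₀
  obtain ⟨r, hr, hr'⟩ := Int.exists_sq_eq_of_emod_three hm r₀
  rw [← hp] at h hp'
  rw [← hq] at h hq'
  rw [← hr] at h hr'
  by_cases h1 : r % 3 = 0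
  · exact ⟨p, q, r, h, by omega⟩
  by_cases h2 : q % 3 = 0
  · exact ⟨p, r, q, by linarith, by omega⟩
  · exact ⟨q, r, p, by linarith, by omega⟩

theorem Int.sq_emod_two (x : ℤ) : x ^ 2 % 2 = x % 2 := by
  rcases Int.emod_two_eq_zero_or_one x with h | h <;> simp [sq, Int.mul_emod, h]

theorem Int.neg_sq_emod_three {m : ℤ} (hm : m % 3 ≠ 0) : -m ^ 2 % 3 = 2 := by
  rcases Int.sq_emod_three m with h | h | h <;> omega

/-- The form `2a² + 3b² + 6c²` represents every sum of three squares that is `2` modulo `3`. -/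
theorem IsSumThreeSquares.exists_two_three_six {N : ℤ} (h : IsSumThreeSquares N)
    (hN : N % 3 = 2) : ∃ a b c : ℤ, N = 2 * a ^ 2 + 3 * b ^ 2 + 6 * c ^ 2 := by
  obtain ⟨p, q, r, h, hp, hq, hr⟩ := h.exists_of_emod_three (m := 1) (by norm_num) hN
  have key : ∀ p q r : ℤ, N = p ^ 2 + q ^ 2 + r ^ 2 → (p + q + r) % 3 = 0 → (p - q) % 2 = 0 →
      ∃ a b c : ℤ, N = 2 * a ^ 2 + 3 * b ^ 2 + 6 * c ^ 2 := by
    intro p q r h h3 h2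
    obtain ⟨a, ha⟩ : ∃ a, p - q = 2 * a := ⟨(p - q) / 2, by omega⟩
    obtain ⟨b, hb⟩ : ∃ b, p + q + r = 3 * b := ⟨(p + q + r) / 3, by omega⟩
    obtain ⟨c, hc⟩ : ∃ c, b - r = 2 * c := ⟨(b - r) / 2, by omega⟩
    refine ⟨a, b, c, ?_⟩
    rw [h, show p = b + c + a by omega, show q = b + c - a by omega, show r = b - 2 * c by omega]
    ring
  -- Two of the three roots share a parity; negating q, one of the two prime to 3, makes the sum
  -- divisible by 3.
  by_cases h1 : (p + q) % 2 = 0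
  · exact key p (-q) r (by linarith [neg_sq q]) (by omega) (by omega)
  by_cases h2 : (p + r) % 2 = 0
  · exact key p r (-q) (by linarith [neg_sq q]) (by omega) (by omega)
  · exact key (-q) r p (by linarith [neg_sq q]) (by omega) (by omega)

/-! ### From three squares to four squares with a linear condition -/

/-- Representations of `n` as a sum of four squares `x² + y² + z² + w²` such that
`x + βy + 2z` is of the form `c * q ^ k`. -/
def IsRestrictedSum (β c q n : ℤ) : Prop :=
  ∃ x y z w : ℤ, n = x ^ 2 + y ^ 2 + z ^ 2 + w ^ 2 ∧ ∃ k : ℕ, x + β * y + 2 * z = c * q ^ k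

theorem IsRestrictedSum.sq_mul {β c q n : ℤ} (h : IsRestrictedSum β c q n) :
    IsRestrictedSum β c q (q ^ 2 * n) := by
  obtain ⟨x, y, z, w, rfl, k, hk⟩ := h
  exact ⟨q * x, q * y, q * z, q * w, by ring, k + 1, by linear_combination q * hk⟩

theorem isRestrictedSum_one_of_isSumThreeSquares {n m c q : ℤ} (k : ℕ) (hk : c * q ^ k = m)
    (hm : m % 3 ≠ 0) (h : IsSumThreeSquares (6 * n - m ^ 2)) : IsRestrictedSum 1 c q n := by
  suffices ∃ x y z w : ℤ, n = x ^ 2 + y ^ 2 + z ^ 2 + w ^ 2 ∧ x + 1 * y + 2 * z = m by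
    obtain ⟨x, y, z, w, h, h'⟩ := this
    exact ⟨x, y, z, w, h, k, h'.trans hk.symm⟩
  have hm3 := Int.neg_sq_emod_three hm
  obtain ⟨a₀, b, c, h⟩ := h.exists_two_three_six (by omega)
  obtain ⟨a, ha, ha'⟩ := Int.exists_sq_eq_of_emod_three hm a₀
  rw [← ha] at h
  have ham : a % 3 = m % 3 := by omega
  have hbm : b % 2 = m % 2 := by
    have := Int.sq_emod_two b
    have := Int.sq_emod_two m
    omega
  obtain ⟨z, hz⟩ : ∃ z, m = a + 3 * z := ⟨(m - a) / 3, by omega⟩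
  obtain ⟨y, hy⟩ : ∃ y, m - 2 * z - b = 2 * y := ⟨(m - 2 * z - b) / 2, by omega⟩
  refine ⟨y + b, y, z, c, ?_, by linarith⟩
  obtain rfl : m = 2 * y + b + 2 * z := by linarith
  obtain rfl : a = 2 * y + b - z := by linarith
  linarith

theorem isRestrictedSum_two_of_isSumThreeSquares {n m c q : ℤ} (k : ℕ) (hk : c * q ^ k = m)
    (hm : m % 3 ≠ 0) (h : IsSumThreeSquares (9 * n - m ^ 2)) : IsRestrictedSum 2 c q n := by
  suffices ∃ x y z w : ℤ, n = x ^ 2 + y ^ 2 + z ^ 2 + w ^ 2 ∧ x + 2 * y + 2 * z = m by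
    obtain ⟨x, y, z, w, h, h'⟩ := this
    exact ⟨x, y, z, w, h, k, h'.trans hk.symm⟩
  have hm3 := Int.neg_sq_emod_three hm
  obtain ⟨p, q, r, h, hp, hq, hr⟩ :=
    h.exists_of_emod_three (m := -m) (by omega) (by omega)
  obtain ⟨i, rfl⟩ : ∃ i, p = -m + 3 * i := ⟨(p + m) / 3, by omega⟩
  obtain ⟨j, rfl⟩ : ∃ j, q = -m + 3 * j := ⟨(q + m) / 3, by omega⟩
  obtain ⟨w, rfl⟩ : ∃ w, r = 3 * w := ⟨r / 3, by omega⟩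
  -- Comparing both sides of 9n = m² + p² + q² + r² modulo 9 gives m + 2p + 2q ≡ 0 modulo 9, as
  -- integrality of x = (m + 2p + 2q)/9 requires.
  have h3 : (3 : ℤ) ∣ m * (m - 2 * (i + j)) :=
    ⟨n - i ^ 2 - j ^ 2 - w ^ 2, by linarith⟩
  have h4 : (3 : ℤ) ∣ m - 2 * (i + j) :=
    (Int.prime_three.dvd_or_dvd h3).resolve_left (by omega)
  obtain ⟨k, hk⟩ : ∃ k, i = 2 * m + 3 * k - j := ⟨(i + j - 2 * m) / 3, by omega⟩
  refine ⟨m + 2 * k, m + k - j, -m - 2 * k + j, w, ?_, by ring⟩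
  subst hk
  linarith

/-- Three squares can be chosen not to be all divisible by `3`. -/
theorem IsSumThreeSquares.exists_not_three_dvd {N : ℤ} (hN : 0 < N) (h : IsSumThreeSquares N) :
    ∃ p q r : ℤ, N = p ^ 2 + q ^ 2 + r ^ 2 ∧ p % 3 ≠ 0 := by
  lift N to ℕ using hN.le
  induction N using Nat.strong_induction_on with
  | _ N ih =>
  obtain ⟨p, q, r, h⟩ := h
  by_cases hp : p % 3 = 0
  · by_cases hq : q % 3 = 0
    · by_cases hr : r % 3 = 0
      · obtain ⟨a, rfl⟩ : ∃ a, p = 3 * a := ⟨p / 3, by omega⟩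
        obtain ⟨b, rfl⟩ : ∃ b, q = 3 * b := ⟨q / 3, by omega⟩
        obtain ⟨c, rfl⟩ : ∃ c, r = 3 * c := ⟨r / 3, by omega⟩
        have h' : (N : ℤ) = 9 * (a ^ 2 + b ^ 2 + c ^ 2) := by linarith
        obtain ⟨M, rfl⟩ : ∃ M, N = 9 * M := ⟨N / 9, by omega⟩
        obtain ⟨a, b, c, hM, ha⟩ := ih M (by omega) (by omega)
          ⟨a, b, c, by push_cast at h'; linarith⟩
        -- The matrix with rows (1,2,2), (2,1,−2), (2,−2,1) multiplies norms by 9. Signs are chosen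
        -- so that the new first entry stays prime to 3.
        obtain ⟨b', hb, hb'⟩ := Int.exists_sq_eq_of_emod_three (m := a) ha b
        obtain ⟨c', hc, hc'⟩ := Int.exists_sq_eq_of_emod_three (m := -a) (by omega) c
        rw [← hb, ← hc] at hM
        by_cases hb0 : b' % 3 = 0
        · exact ⟨a + 2 * b' + 2 * c', 2 * a + b' - 2 * c', 2 * a - 2 * b' + c',
            by push_cast; rw [hM]; ring, by omega⟩
        by_cases hc0 : c' % 3 = 0
        · exact ⟨a - 2 * b' + 2 * c', 2 * a - b' - 2 * c', 2 * a + 2 * b' + c',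
            by push_cast; rw [hM]; ring, by omega⟩
        · exact ⟨a + 2 * b' + 2 * c', 2 * a + b' - 2 * c', 2 * a - 2 * b' + c',
            by push_cast; rw [hM]; ring, by omega⟩
      · exact ⟨r, p, q, by linarith, hr⟩
    · exact ⟨q, p, r, by linarith, hq⟩
  · exact ⟨p, q, r, h, hp⟩

theorem isRestrictedSum_two_three_of_isSumThreeSquares {n m q : ℤ} (k : ℕ) (hk : q ^ k = m)
    (hm : m % 3 ≠ 0) (hn : m ^ 2 < n) (h : IsSumThreeSquares (n - m ^ 2)) :
    IsRestrictedSum 2 3 q n := by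
  suffices ∃ x y z w : ℤ, n = x ^ 2 + y ^ 2 + z ^ 2 + w ^ 2 ∧ x + 2 * y + 2 * z = 3 * m by
    obtain ⟨x, y, z, w, h, h'⟩ := this
    exact ⟨x, y, z, w, h, k, by rw [h', hk]⟩
  obtain ⟨p, q, w, h, hpq⟩ : ∃ p q w : ℤ, n - m ^ 2 = p ^ 2 + q ^ 2 + w ^ 2 ∧
      (p + q) % 3 = m % 3 := by
    obtain ⟨p, q, r, h, hp⟩ := h.exists_not_three_dvd (by linarith)
    by_cases hq : q % 3 = 0
    · obtain ⟨p', hp, hp'⟩ := Int.exists_sq_eq_of_emod_three hm p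
      have := Int.sq_emod_three p
      exact ⟨p', q, r, by rw [h, hp], by omega⟩
    · obtain ⟨p', hp, hp'⟩ := Int.exists_sq_eq_of_emod_three (m := -m) (by omega) p
      obtain ⟨q', hq, hq'⟩ := Int.exists_sq_eq_of_emod_three (m := -m) (by omega) q
      have := Int.sq_emod_three p
      have := Int.sq_emod_three q
      exact ⟨p', q', r, by rw [h, hp, hq], by omega⟩
  -- The witnesses solve x+2y+2z = 3m, 2x+y−2z = 3p, 2x−2y+z = 3q; integrality is p + q ≡ m modulo
  -- 3.
  obtain ⟨k, hk⟩ : ∃ k, p = m + 3 * k - q := ⟨(p + q - m) / 3, by omega⟩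
  refine ⟨m + 2 * k, m + k - q, q - 2 * k, w, ?_, by ring⟩
  subst hk
  linarith

/-! ### Choosing m by residues of n -/

theorem isRestrictedSum_one_one_four {n : ℕ} (hn : 1 ≤ n) : IsRestrictedSum 1 1 4 n := by
  induction n using Nat.strong_induction_on with
  | _ n ih =>
  by_cases h16 : n % 16 = 0
  · obtain ⟨k, rfl⟩ : ∃ k, n = 16 * k := ⟨n / 16, by omega⟩
    exact_mod_cast (ih k (by omega) (by omega)).sq_mul
  by_cases h4 : n % 4 = 0
  -- For n ≡ 24 modulo 32, m = 4 may meet an exception, so m = 16 is used; at n = 24 it would make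
  -- 6n − m² negative.
  · by_cases h24 : n % 32 = 24 ∧ n ≠ 24
    · refine isRestrictedSum_one_of_isSumThreeSquares 2 (m := 16) (by norm_num) (by norm_num) ?_
      obtain ⟨j, hj⟩ : ∃ j : ℤ, 6 * (n : ℤ) - 16 ^ 2 = 4 * (4 * j) ∧ 0 < j ∧ j % 4 = 1 :=
        ⟨(6 * (n : ℤ) - 16 ^ 2) / 16, by omega⟩
      rw [hj.1]
      exact (isSumThreeSquares_of_not_four_dvd (by omega) (by omega) (by omega)).four_mul.four_mul
    · refine isRestrictedSum_one_of_isSumThreeSquares 1 (m := 4) (by norm_num) (by norm_num) ?_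
      by_cases h8 : n % 8 = 4
      · obtain ⟨j, hj⟩ : ∃ j : ℤ, 6 * (n : ℤ) - 4 ^ 2 = 4 * j ∧ 0 < j ∧ j % 4 = 2 :=
          ⟨(6 * (n : ℤ) - 4 ^ 2) / 4, by omega⟩
        rw [hj.1]
        exact (isSumThreeSquares_of_not_four_dvd (by omega) (by omega) (by omega)).four_mul
      · by_cases hn24 : n = 24
        · subst hn24
          exact ⟨8, 8, 0, by norm_num⟩
        · obtain ⟨j, hj⟩ : ∃ j : ℤ, 6 * (n : ℤ) - 4 ^ 2 = 4 * (4 * j) ∧ 0 < j ∧ j % 4 = 2 :=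
            ⟨(6 * (n : ℤ) - 4 ^ 2) / 16, by omega⟩
          rw [hj.1]
          exact (isSumThreeSquares_of_not_four_dvd (by omega) (by omega)
            (by omega)).four_mul.four_mul
  · refine isRestrictedSum_one_of_isSumThreeSquares 0 (m := 1) (by norm_num) (by norm_num) ?_
    exact isSumThreeSquares_of_not_four_dvd (by omega) (by omega) (by omega)

theorem isRestrictedSum_one_two_four {n : ℕ} (hn : 1 ≤ n) : IsRestrictedSum 1 2 4 n := by
  induction n using Nat.strong_induction_on with
  | _ n ih =>
  by_cases h16 : n % 16 = 0
  · obtain ⟨k, rfl⟩ : ∃ k, n = 16 * k := ⟨n / 16, by omega⟩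
    exact_mod_cast (ih k (by omega) (by omega)).sq_mul
  by_cases h : IsSumThreeSquares (6 * n - 2 ^ 2)
  · exact isRestrictedSum_one_of_isSumThreeSquares 0 (m := 2) (by norm_num) (by norm_num) h
  · have hbad := (isSumThreeSquares_or_mod (n := 6 * n - 2 ^ 2) (by omega)).resolve_left h
    refine isRestrictedSum_one_of_isSumThreeSquares 1 (m := 8) (by norm_num) (by norm_num) ?_
    -- Failure of m = 2 forces n ≡ 6 modulo 8 and n ≥ 20, hence the positivity.
    obtain ⟨j, hj⟩ : ∃ j : ℤ, 6 * (n : ℤ) - 8 ^ 2 = 4 * j ∧ 0 < j ∧ j % 4 = 1 :=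
      ⟨(6 * (n : ℤ) - 8 ^ 2) / 4, by omega⟩
    rw [hj.1]
    exact (isSumThreeSquares_of_not_four_dvd (by omega) (by omega) (by omega)).four_mul

theorem isRestrictedSum_two_one_four {n : ℕ} (hn : 1 ≤ n) : IsRestrictedSum 2 1 4 n := by
  induction n using Nat.strong_induction_on with
  | _ n ih =>
  by_cases h16 : n % 16 = 0
  · obtain ⟨k, rfl⟩ : ∃ k, n = 16 * k := ⟨n / 16, by omega⟩
    exact_mod_cast (ih k (by omega) (by omega)).sq_mul
  by_cases h : IsSumThreeSquares (9 * n - 1 ^ 2)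
  · exact isRestrictedSum_two_of_isSumThreeSquares 0 (m := 1) (by norm_num) (by norm_num) h
  · have hbad := (isSumThreeSquares_or_mod (n := 9 * n - 1 ^ 2) (by omega)).resolve_left h
    refine isRestrictedSum_two_of_isSumThreeSquares 1 (m := 4) (by norm_num) (by norm_num) ?_
    -- Failure of m = 1 leaves n ≡ 8, 9 modulo 16 or n ≡ 5 modulo 8, for which 9n − 16 is never
    -- exceptional.
    exact ((isSumThreeSquares_or_mod (by omega)).resolve_right (by omega))

theorem isRestrictedSum_two_one_eight_sq {n : ℕ} (hn : 1 ≤ n) :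
    IsRestrictedSum 2 1 8 ((n : ℤ) ^ 2) := by
  induction n using Nat.strong_induction_on with
  | _ n ih =>
  by_cases h8 : n % 8 = 0
  · obtain ⟨k, rfl⟩ : ∃ k, n = 8 * k := ⟨n / 8, by omega⟩
    have := (ih k (by omega) (by omega)).sq_mul
    rw [← mul_pow] at this
    exact_mod_cast this
  have hsq (j : ℕ) : ∃ i : ℕ, (2 * (j : ℤ) + 1) ^ 2 = 8 * i + 1 := by
    obtain ⟨i, hi⟩ := (Nat.even_mul_succ_self j).two_dvd
    exact ⟨i, by zify at hi; linarith⟩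
  rcases (by omega : n = 1 ∨ 3 ≤ n ∧ n % 2 = 1 ∨ n % 4 = 2 ∨ n % 8 = 4) with h | h | h | h
  · subst h
    exact isRestrictedSum_two_of_isSumThreeSquares 0 (m := 1) (by norm_num) (by norm_num)
      ⟨2, 2, 0, by norm_num⟩
  · refine isRestrictedSum_two_of_isSumThreeSquares 1 (m := 8) (by norm_num) (by norm_num) ?_
    have h9 : 9 ≤ n ^ 2 := by nlinarith
    obtain ⟨j, rfl⟩ : ∃ j, n = 2 * j + 1 := ⟨n / 2, by omega⟩
    obtain ⟨i, hi⟩ := hsq j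
    zify at h9
    push_cast
    exact isSumThreeSquares_of_not_four_dvd (by omega) (by omega) (by omega)
  · refine isRestrictedSum_two_of_isSumThreeSquares 0 (m := 1) (by norm_num) (by norm_num) ?_
    obtain ⟨j, rfl⟩ : ∃ j, n = 2 * (2 * j + 1) := ⟨n / 4, by omega⟩
    obtain ⟨i, hi⟩ := hsq j
    push_cast
    rw [mul_pow]
    exact isSumThreeSquares_of_not_four_dvd (by omega) (by omega) (by omega)
  · refine isRestrictedSum_two_of_isSumThreeSquares 1 (m := 8) (by norm_num) (by norm_num) ?_
    obtain ⟨j, rfl⟩ : ∃ j, n = 4 * (2 * j + 1) := ⟨n / 8, by omega⟩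
    obtain ⟨i, hi⟩ := hsq j
    push_cast
    rw [show 9 * (4 * (2 * (j : ℤ) + 1)) ^ 2 - 64 = 4 * (4 * (9 * (2 * (j : ℤ) + 1) ^ 2 - 4)) by
      ring]
    exact (isSumThreeSquares_of_not_four_dvd (by omega) (by omega) (by omega)).four_mul.four_mul

theorem isRestrictedSum_two_three_four {n : ℕ} (hn : 1 ≤ n)
    (h0 : ∀ k : ℕ, n ≠ 2 ^ (4 * k) ∧ n ≠ 2 ^ (4 * k + 3)) : IsRestrictedSum 2 3 4 n := by
  induction n using Nat.strong_induction_on with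
  | _ n ih =>
  by_cases h16 : n % 16 = 0
  · obtain ⟨k, rfl⟩ : ∃ k, n = 16 * k := ⟨n / 16, by omega⟩
    refine mod_cast (ih k (by omega) (by omega) fun i => ?_).sq_mul
    have h1 := h0 (i + 1)
    constructor <;> rintro rfl
    · exact h1.1 (by ring)
    · exact h1.2 (by ring)
  -- Excluding n = 1 and n = 8 ensures that n > 1 and that n > 16 whenever m = 1 fails.
  have h1 := h0 0
  norm_num at h1
  by_cases h : IsSumThreeSquares (n - 1 ^ 2)
  · exact isRestrictedSum_two_three_of_isSumThreeSquares 0 (m := 1) (by norm_num) (by norm_num)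
      (by omega) h
  · have hbad := (isSumThreeSquares_or_mod (n := n - 1 ^ 2) (by omega)).resolve_left h
    exact isRestrictedSum_two_three_of_isSumThreeSquares 1 (m := 4) (by norm_num) (by norm_num)
      (by omega) ((isSumThreeSquares_or_mod (by omega)).resolve_right (by omega))

theorem IsRestrictedSum.pow_mul {β c q n : ℤ} (h : IsRestrictedSum β c q n) (k : ℕ) :
    IsRestrictedSum β c q (q ^ (2 * k) * n) := by
  induction k with
  | zero => simpa using h
  | succ k ih =>
    have := ih.sq_mul
    rwa [← mul_assoc, ← pow_add, add_comm, ← mul_add_one] at this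

theorem isRestrictedSum_two_three_two {n : ℕ} (hn : 1 < n) : IsRestrictedSum 2 3 2 n := by
  by_cases h0 : ∀ k : ℕ, n ≠ 2 ^ (4 * k) ∧ n ≠ 2 ^ (4 * k + 3)
  · obtain ⟨x, y, z, w, h, k, hk⟩ := isRestrictedSum_two_three_four hn.le h0
    exact ⟨x, y, z, w, h, 2 * k, by rw [hk, pow_mul]; norm_num⟩
  · have h16 : IsRestrictedSum 2 3 2 16 := ⟨-2, 2, 2, 2, by norm_num, 1, by norm_num⟩
    have h8 : IsRestrictedSum 2 3 2 8 := ⟨2, 2, 0, 0, by norm_num, 1, by norm_num⟩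
    push Not at h0
    obtain ⟨k, hk⟩ := h0
    by_cases h : n = 2 ^ (4 * k)
    · subst h
      rcases k with _ | k
      · simp at hn
      · convert h16.pow_mul (2 * k) using 1
        push_cast
        ring
    · rw [hk h]
      convert h8.pow_mul (2 * k) using 1
      push_cast
      ring

theorem theorem1p4 :
    -- (i)
    (∀ c ∈ ({1, 2} : Set ℤ), ∀ n : ℕ, 1 ≤ n →
      ∃ x y z w : ℤ, (n : ℤ) = x ^ 2 + y ^ 2 + z ^ 2 + w ^ 2 ∧
        ∃ k : ℕ, x + y + 2 * z = c * 4 ^ k) ∧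
    -- (ii), first assertion
    (∀ n : ℕ, 1 ≤ n →
      ∃ x y z w : ℤ, (n : ℤ) = x ^ 2 + y ^ 2 + z ^ 2 + w ^ 2 ∧
        ∃ k : ℕ, x + 2 * y + 2 * z = 4 ^ k) ∧
    -- (ii), second assertion
    (∀ n : ℕ, 1 ≤ n →
      ∃ x y z w : ℤ, (n : ℤ) ^ 2 = x ^ 2 + y ^ 2 + z ^ 2 + w ^ 2 ∧
        ∃ k : ℕ, x + 2 * y + 2 * z = 8 ^ k) ∧
    -- (iii), first assertion
    (∀ n : ℕ, 1 ≤ n →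
      n ∉ ⋃ k : ℕ, ({2 ^ (4 * k), 2 ^ (4 * k + 3)} : Set ℕ) →
      ∃ x y z w : ℤ, (n : ℤ) = x ^ 2 + y ^ 2 + z ^ 2 + w ^ 2 ∧
        ∃ k : ℕ, x + 2 * y + 2 * z = 3 * 4 ^ k) ∧
    -- (iii), second assertion
    (∀ n : ℕ, 1 < n →
      ∃ x y z w : ℤ, (n : ℤ) = x ^ 2 + y ^ 2 + z ^ 2 + w ^ 2 ∧
        ∃ k : ℕ, x + 2 * y + 2 * z = 3 * 2 ^ k) := by
  simp only [Set.mem_insert_iff, Set.mem_singleton_iff]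
  refine ⟨?_, fun n hn => ?_, fun n hn => ?_, fun n hn h => ?_,
    fun n hn => isRestrictedSum_two_three_two hn⟩
  · rintro c (rfl | rfl) n hn
    · simpa only [IsRestrictedSum, one_mul] using isRestrictedSum_one_one_four hn
    · simpa only [IsRestrictedSum, one_mul] using isRestrictedSum_one_two_four hn
  · simpa only [IsRestrictedSum, one_mul] using isRestrictedSum_two_one_four hn
  · simpa only [IsRestrictedSum, one_mul] using isRestrictedSum_two_one_eight_sq hn
  · refine isRestrictedSum_two_three_four hn fun k => ?_
    simp only [Set.mem_iUnion, not_exists, Set.mem_insert_iff, Set.mem_singleton_iff, not_or] at h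
    exact h k
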